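/- Let $d\in\mathbb N$, $T>0$ and $2\sigma\in(0,\tfrac12)$. Let $\nu$ be a L\'evy measure of order less than one on $\mathbb R^d$, i.e. a nonnegative Borel measure with $\nu(\{0\})=0$ and $\int_{\mathbb R^d}(1\wedge|z|)\,\nu(dz)<\infty$, such that for some constant $K\ge 0$ $$\int_{B_1}\Big(1\wedge\frac{|z|^p}{r^p}\Big)\nu(dz)\le\frac{K}{p-2\sigma}\,r^{-2\sigma}\qquad\text{for all }p\in(2\sigma,1],\ r\in(0,1).\tag{L}$$ Put $\mathcal L\psi(x)=\int_{\mathbb R^d}(\psi(x+z)-\psi(x))\,\nu(dz)$, and for $r\in(0,1)$ let $\mathcal L_r$ and $\mathcal L^r$ be given by the same integral over $B_r$ and over $\mathbb R^d\setminus B_r$, respectively, where $B_r$ is the open ball of radius $r$ centred at $0$. For $\alpha\in(0,1]$ let $\|\psi\|_\alpha=\sup_x|\psi(x)|+\sup_x\sup_{0<|x-y|<1}\frac{|\psi(x)-\psi(y)|}{|x-y|^\alpha}$, and let $B(\alpha)$ be the set of $u:(0,T)\times\mathbb R^d\to\mathbb R$ with $\sup_{t\in(0,T)}\|u(t,\cdot)\|_\alpha<\infty$.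 Let $b$ be continuous on $(0,T)\times\mathbb R^d$ with values in $[0,B]$ for some $B<\infty$ and $b\in B(\beta)$, where $\beta$ is specified below, and let $\phi\in C^1_b(\mathbb R^d)$ ($\phi$ is $C^1$, and $\phi$ and $\nabla\phi$ are bounded). Consider $$\partial_t w-b\,\mathcal L w=0\ \text{ on }(0,T)\times\mathbb R^d,\qquad w(0)=\phi\ \text{ on }\mathbb R^d.\tag{1}$$ A bounded upper semicontinuous $u:[0,T]\times\mathbb R^d\to\mathbb R$ is a viscosity subsolution of (1) if $u(0,\cdot)\le\phi$ and, for all $r\in(0,1)$, all $\psi\in C^1((0,T)\times\mathbb R^d)$ and every global maximum point $(t,x)\in(0,T)\times\mathbb R^d$ of $u-\psi$ over $(0,T)\times\mathbb R^d$, $$\partial_t\psi(t,x)-b(t,x)\big(\mathcal L^r u+\mathcal L_r\psi\big)(t,x)\le 0 .$$ Supersolutions are defined with lower semicontinuous, minimum and $\ge$ instead of upper semicontinuous, maximum and $\le$; a viscosity solution is both a sub- and a supersolution. Then: 1. If $\beta\in\big(\frac{2\sigma}{1-2\sigma},1\big]$, there is a viscosity solution $w$ of (1) with $w\in B(\beta_0)$,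 $\beta_0=\beta-\frac{2\sigma}{1-2\sigma}$. 2. If $\nu$ is symmetric at the origin, i.e. $\nu(A)=\nu(-A)$ for all Borel $A\subset B_1$, and $\beta\in\big(\frac{2\sigma}{1-\sigma},1\big]$, there is a viscosity solution $w$ of (1) with $w\in B(\beta_0)$, $\beta_0=\beta-\frac{2\sigma}{1-\sigma}$. -/

import Mathlib

open Set MeasureTheory
open scoped ENNReal Pointwise

noncomputable section

namespace DegenerateDual

/-- The state space `ℝ^d` with its Euclidean norm. -/
abbrev Space (d : ℕ) : Type := EuclideanSpace ℝ (Fin d)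

/-- Lévy measures of order less than one: Borel measures on `ℝ^d` without mass at the origin and
with `∫ (1 ∧ |z|) ν(dz) < ∞`. Such a measure may be infinite near the origin; it is automatically
finite outside every neighbourhood of the origin. -/
structure IsLevyMeasure {d : ℕ} (ν : Measure (Space d)) : Prop where
  zero_mass : ν {0} = 0
  integral_lt_top : ∫⁻ z, ENNReal.ofReal (min 1 ‖z‖) ∂ν < ∞

/-- `ν` is symmetric at the origin: `ν(A) = ν(-A)` for all Borel subsets `A` of the unit ball. -/
def IsSymmetricAtOrigin {d : ℕ} (ν : Measure (Space d)) : Prop :=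
  ∀ A : Set (Space d), MeasurableSet A → A ⊆ Metric.ball 0 1 → ν A = ν (-A)

/-- The growth condition at the origin (of order `2σ`):
`∫_{B_1} (1 ∧ |z|^p / r^p) ν(dz) ≤ K / (p - 2σ) * r^(-2σ)` for some constant `K ≥ 0` and all
`p ∈ (2σ, 1]`, `r ∈ (0, 1)`. -/
def LevyGrowth {d : ℕ} (ν : Measure (Space d)) (σ : ℝ) : Prop :=
  ∃ K : ℝ, 0 ≤ K ∧ ∀ p ∈ Ioc (2 * σ) 1, ∀ r ∈ Ioo (0 : ℝ) 1,
    ∫⁻ z in Metric.ball (0 : Space d) 1, ENNReal.ofReal (min 1 (‖z‖ ^ p / r ^ p)) ∂ν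
      ≤ ENNReal.ofReal (K / (p - 2 * σ) * r ^ (-(2 * σ)))

/-- The part of the Lévy operator `𝓛 φ(x) = ∫ (φ(x + z) - φ(x)) ν(dz)` in which the jumps `z` are
restricted to `A`; the operator `𝓛` itself is the case `A = univ`. -/
def levyOpOn {d : ℕ} (ν : Measure (Space d)) (A : Set (Space d)) (φ : Space d → ℝ)
    (x : Space d) : ℝ :=
  ∫ z in A, (φ (x + z) - φ x) ∂ν

/-- `𝓛_r`: the jumps inside the ball of radius `r`. -/
def levyInner {d : ℕ} (ν : Measure (Space d)) (r : ℝ) (φ : Space d → ℝ) (x : Space d) : ℝ :=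
  levyOpOn ν (Metric.ball 0 r) φ x

/-- `𝓛^r`: the jumps outside the ball of radius `r`. -/
def levyOuter {d : ℕ} (ν : Measure (Space d)) (r : ℝ) (φ : Space d → ℝ) (x : Space d) : ℝ :=
  levyOpOn ν (Metric.ball 0 r)ᶜ φ x

/-- `u` is bounded on `[0, T] × ℝ^d`. -/
def BoundedOnStrip {d : ℕ} (T : ℝ) (u : ℝ → Space d → ℝ) : Prop :=
  ∃ C : ℝ, ∀ t ∈ Icc 0 T, ∀ x, |u t x| ≤ C

/-- `ψ ∈ C¹((0, T) × ℝ^d)`. -/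
def IsTestFunction {d : ℕ} (T : ℝ) (ψ : ℝ → Space d → ℝ) : Prop :=
  ContDiffOn ℝ 1 (fun q : ℝ × Space d => ψ q.1 q.2) (Ioo 0 T ×ˢ univ)

/-- Viscosity subsolutions of `∂_t w = H(t, x, 𝓛 w)` on `(0, T) × ℝ^d`, `w(0) = w₀`. -/
structure IsViscositySubsolution {d : ℕ} (ν : Measure (Space d)) (T : ℝ)
    (H : ℝ → Space d → ℝ → ℝ) (w₀ : Space d → ℝ) (u : ℝ → Space d → ℝ) : Prop where
  bounded : BoundedOnStrip T u
  usc : UpperSemicontinuousOn (fun q : ℝ × Space d => u q.1 q.2) (Icc 0 T ×ˢ univ)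
  initial : ∀ x, u 0 x ≤ w₀ x
  test : ∀ r ∈ Ioo (0 : ℝ) 1, ∀ ψ : ℝ → Space d → ℝ, IsTestFunction T ψ →
    ∀ t ∈ Ioo 0 T, ∀ x : Space d,
      IsMaxOn (fun q : ℝ × Space d => u q.1 q.2 - ψ q.1 q.2) (Ioo 0 T ×ˢ univ) (t, x) →
        deriv (fun s => ψ s x) t - H t x (levyOuter ν r (u t) x + levyInner ν r (ψ t) x) ≤ 0

/-- Viscosity supersolutions of `∂_t w = H(t, x, 𝓛 w)` on `(0, T) × ℝ^d`, `w(0) = w₀`. -/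
structure IsViscositySupersolution {d : ℕ} (ν : Measure (Space d)) (T : ℝ)
    (H : ℝ → Space d → ℝ → ℝ) (w₀ : Space d → ℝ) (u : ℝ → Space d → ℝ) : Prop where
  bounded : BoundedOnStrip T u
  lsc : LowerSemicontinuousOn (fun q : ℝ × Space d => u q.1 q.2) (Icc 0 T ×ˢ univ)
  initial : ∀ x, w₀ x ≤ u 0 x
  test : ∀ r ∈ Ioo (0 : ℝ) 1, ∀ ψ : ℝ → Space d → ℝ, IsTestFunction T ψ →
    ∀ t ∈ Ioo 0 T, ∀ x : Space d,
      IsMinOn (fun q : ℝ × Space d => u q.1 q.2 - ψ q.1 q.2) (Ioo 0 T ×ˢ univ) (t, x) →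
        0 ≤ deriv (fun s => ψ s x) t - H t x (levyOuter ν r (u t) x + levyInner ν r (ψ t) x)

/-- Viscosity solutions of `∂_t w = H(t, x, 𝓛 w)` on `(0, T) × ℝ^d`, `w(0) = w₀`. -/
def IsViscositySolution {d : ℕ} (ν : Measure (Space d)) (T : ℝ)
    (H : ℝ → Space d → ℝ → ℝ) (w₀ : Space d → ℝ) (w : ℝ → Space d → ℝ) : Prop :=
  IsViscositySubsolution ν T H w₀ w ∧ IsViscositySupersolution ν T H w₀ w

/-- Viscosity solutions of the dual equation `∂_t w - b 𝓛 w = 0`, `w(0) = φ`. -/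
def IsDualViscositySolution {d : ℕ} (ν : Measure (Space d)) (T : ℝ)
    (b : ℝ → Space d → ℝ) (φ : Space d → ℝ) (w : ℝ → Space d → ℝ) : Prop :=
  IsViscositySolution ν T (fun t x l => b t x * l) φ w

/-- The Hölder seminorm `[φ]_α = sup_x sup_{0 < |y - x| < 1} |φ(x) - φ(y)| / |x - y|^α`. -/
def holderSeminorm {d : ℕ} (α : ℝ) (φ : Space d → ℝ) : ℝ≥0∞ :=
  ⨆ x : Space d, ⨆ y ∈ Metric.ball x 1 \ {x}, ENNReal.ofReal (|φ x - φ y| / ‖x - y‖ ^ α)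

/-- The Hölder norm `‖φ‖_α = ‖φ‖_∞ + [φ]_α`. -/
def holderNorm {d : ℕ} (α : ℝ) (φ : Space d → ℝ) : ℝ≥0∞ :=
  (⨆ x : Space d, ENNReal.ofReal |φ x|) + holderSeminorm α φ

/-- The space `B((0, T), C^α_b(ℝ^d))`: functions with `sup_{t ∈ (0, T)} ‖u(t)‖_α < ∞`. -/
def MemBoundedHolder {d : ℕ} (T α : ℝ) (u : ℝ → Space d → ℝ) : Prop :=
  (⨆ t ∈ Ioo 0 T, holderNorm α (u t)) < ∞

/-- The assumption on the coefficient: `b` is continuous on `(0, T) × ℝ^d`, takes values in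
`[0, B]` for some finite `B`, and belongs to `B((0, T), C^β_b(ℝ^d))`. -/
structure IsAdmissibleCoeff {d : ℕ} (T β : ℝ) (b : ℝ → Space d → ℝ) : Prop where
  continuousOn : ContinuousOn (fun q : ℝ × Space d => b q.1 q.2) (Ioo 0 T ×ˢ univ)
  range : ∃ B : ℝ, 0 ≤ B ∧ ∀ t ∈ Ioo 0 T, ∀ x, b t x ∈ Icc 0 B
  holder : MemBoundedHolder T β b

/-- `φ ∈ C¹_b(ℝ^d)`: continuously differentiable, bounded, with bounded derivative. -/
structure IsC1Bounded {d : ℕ} (φ : Space d → ℝ) : Prop where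
  contDiff : ContDiff ℝ 1 φ
  bounded : ∃ C : ℝ, ∀ x, |φ x| ≤ C
  deriv_bounded : ∃ C : ℝ, ∀ x, ‖fderiv ℝ φ x‖ ≤ C

end DegenerateDual

end

namespace DegenerateDual

open Filter Topology
open scoped BoundedContinuousFunction

variable {d : ℕ}

/-! Since β > 2σ, `LevyGrowth` makes g(z) = 1 ∧ |z|^β integrable for ν. Hence 𝓛 acts classically on
functions with modulus M g, and the evolution ∂_t w = b 𝓛 w keeps such a modulus, with M growing
exponentially in time. No Hölder exponent is lost: there is a solution in B(β), differentiable in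
time, and both claims are weakenings of this.

The modulus is propagated by comparing u with its translate v = u - u(· + y - x). The difference of
b 𝓛 u at x and at y is b(y) 𝓛v(x) + (b(x) - b(y)) 𝓛u(x). The first term is controlled by the maximum
principle, the second by C g(x - y) · M κ with κ = ∫ g dν, so Gronwall's inequality gives M
exp(Cκt); see `abs_relaxed_sub_le`.

For a finite measure μ, adding B μ(ℝ^d) u makes the operator positive, and Picard iteration with an
integrating factor yields a solution (`exists_solution_of_isFiniteMeasure`). Neither its modulus nor
the stability estimate `abs_sub_le_of_hasDerivAt` depends on μ(ℝ^d). Removing small balls from ν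
therefore gives a uniformly Cauchy sequence, whose limit solves the equation classically
(`exists_classical_solution`) and hence in the viscosity sense. -/

/-- The modulus `1 ∧ |z|^β`. -/
noncomputable def holderGauge (β : ℝ) (z : Space d) : ℝ := min 1 (‖z‖ ^ β)

theorem holderGauge_nonneg (β : ℝ) (z : Space d) : 0 ≤ holderGauge β z :=
  le_min zero_le_one (Real.rpow_nonneg (norm_nonneg z) β)

theorem holderGauge_neg (β : ℝ) (z : Space d) : holderGauge β (-z) = holderGauge β z := by
  simp [holderGauge]

theorem continuous_holderGauge {β : ℝ} (hβ : 0 ≤ β) :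
    Continuous (holderGauge β : Space d → ℝ) :=
  continuous_const.min (continuous_norm.rpow_const fun _ => Or.inr hβ)

theorem holderGauge_zero {β : ℝ} (hβ : β ≠ 0) : holderGauge β (0 : Space d) = 0 := by
  simp [holderGauge, Real.zero_rpow hβ]

/-! ### The jump operator and its positive perturbation -/

/-- The operator `u ↦ ∫ (u(x + z) - u(x)) μ(dz)`. -/
noncomputable def jump (μ : Measure (Space d)) (u : Space d → ℝ) (x : Space d) : ℝ :=
  ∫ z, (u (x + z) - u x) ∂μ

/-- The zeroth order perturbation `B μ(ℝ^d) u + c ∫ (u(x + z) - u(x)) μ(dz)`, which is a positive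
operator when `0 ≤ c ≤ B`. -/
noncomputable def relaxed (μ : Measure (Space d)) (B c : ℝ) (u : Space d → ℝ) (x : Space d) : ℝ :=
  B * μ.real univ * u x + c * jump μ u x

theorem jump_eq {μ : Measure (Space d)} [IsFiniteMeasure μ] {u : Space d → ℝ} {x : Space d}
    (hu : Integrable (fun z => u (x + z)) μ) :
    jump μ u x = ∫ z, u (x + z) ∂μ - μ.real univ * u x := by
  rw [jump, integral_sub hu (integrable_const _), integral_const, smul_eq_mul]

theorem jump_sub {μ : Measure (Space d)} {u v : Space d → ℝ} {x : Space d}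
    (hu : Integrable (fun z => u (x + z) - u x) μ) (hv : Integrable (fun z => v (x + z) - v x) μ) :
    jump μ (fun y => u y - v y) x = jump μ u x - jump μ v x := by
  rw [jump, jump, jump, ← integral_sub hu hv]
  congr 1
  ext z
  ring

/-- The operator is (B - c) μ(ℝ^d) u(x) + c ∫ u(x + z) μ(dz). For 0 ≤ c ≤ B both weights are
nonnegative, and their total mass is B μ(ℝ^d) whatever c is. -/
theorem abs_relaxed_le {μ : Measure (Space d)} [IsFiniteMeasure μ] {B c N : ℝ}
    {u : Space d → ℝ} {x : Space d} (hc : 0 ≤ c) (hcB : c ≤ B)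
    (hu : Integrable (fun z => u (x + z)) μ) (hN : ∀ y, |u y| ≤ N) :
    |relaxed μ B c u x| ≤ B * μ.real univ * N := by
  have hΛ : 0 ≤ μ.real univ := measureReal_nonneg
  have h1 : |∫ z, u (x + z) ∂μ| ≤ N * μ.real univ :=
    (norm_integral_le_of_norm_le_const (μ := μ) (f := fun z => u (x + z))
      (ae_of_all _ fun z => hN (x + z)) :)
  have h2 : relaxed μ B c u x = (B - c) * μ.real univ * u x + c * ∫ z, u (x + z) ∂μ := by
    rw [relaxed, jump_eq hu]; ring
  have h3 : 0 ≤ (B - c) * μ.real univ := mul_nonneg (sub_nonneg.2 hcB) hΛ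
  rw [h2]
  calc _ ≤ |(B - c) * μ.real univ * u x| + |c * ∫ z, u (x + z) ∂μ| := abs_add_le _ _
    _ = (B - c) * μ.real univ * |u x| + c * |∫ z, u (x + z) ∂μ| := by
        rw [abs_mul, abs_mul c, abs_of_nonneg h3, abs_of_nonneg hc]
    _ ≤ (B - c) * μ.real univ * N + c * (N * μ.real univ) := by
        gcongr
        exact hN x
    _ = _ := by ring

theorem abs_jump_le {μ : Measure (Space d)} {u : Space d → ℝ} {x : Space d} {g : Space d → ℝ}
    (hg : Integrable g μ) (h : ∀ z, |u (x + z) - u x| ≤ g z) : |jump μ u x| ≤ ∫ z, g z ∂μ :=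
  (norm_integral_le_of_norm_le (f := fun z => u (x + z) - u x) hg (ae_of_all _ h) :)

/-- The key estimate. The term B μ(ℝ^d) is later cancelled exactly by the integrating factor, so
only C κ enters the growth rate of the modulus, and it stays bounded when μ exhausts an infinite ν.
-/
theorem abs_relaxed_sub_le {μ : Measure (Space d)} [IsFiniteMeasure μ] {β B C M κ c c' : ℝ}
    {u : Space d → ℝ} {x y : Space d} (hc : 0 ≤ c) (hcB : c ≤ B) (hc' : 0 ≤ c') (hcB' : c' ≤ B)
    (hcc : |c - c'| ≤ C * holderGauge β (x - y))
    (hu : ∀ x, Integrable (fun z => u (x + z)) μ) (hM : 0 ≤ M)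
    (hg : Integrable (holderGauge β) μ) (hκ : ∫ z, holderGauge β z ∂μ ≤ κ)
    (h : ∀ x y, |u x - u y| ≤ M * holderGauge β (x - y)) :
    |relaxed μ B c u x - relaxed μ B c' u y|
      ≤ (B * μ.real univ + C * κ) * (M * holderGauge β (x - y)) := by
  wlog hle : c' ≤ c generalizing c c' x y with H
  · have := H hc' hcB' hc hcB (by
      rw [abs_sub_comm, ← neg_sub x y, holderGauge_neg]; exact hcc) (le_of_not_ge hle)
    rwa [abs_sub_comm, ← neg_sub x y, holderGauge_neg] at this
  set v : Space d → ℝ := fun z => u z - u (y - x + z) with hv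
  have hv' : ∀ z, |v z| ≤ M * holderGauge β (x - y) := fun z => by
    have := h z (y - x + z)
    rwa [show z - (y - x + z) = x - y by abel] at this
  have hu2 : Integrable (fun z => u (y - x + (x + z))) μ := by
    simpa [← add_assoc] using hu y
  have hvi : Integrable (fun z => v (x + z)) μ := (hu x).sub hu2
  -- Translation invariance turns the operator at y into the operator at x acting on the translate
  -- of u. The bound on v is uniform, so positivity applies to the first term; only the second sees
  -- the variation of c.
  have e : relaxed μ B c u x - relaxed μ B c' u y
      = relaxed μ B c' v x + (c - c') * jump μ u x := by
    have : jump μ v x = jump μ u x - jump μ u y := by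
      rw [jump_eq hvi, jump_eq (hu x), jump_eq (hu y)]
      simp only [hv]
      rw [integral_sub (hu x) hu2]
      simp only [← add_assoc, sub_add_cancel]
      ring
    rw [relaxed, relaxed, relaxed, this]
    simp only [hv, sub_add_cancel]
    ring
  have h1 := abs_relaxed_le hc' hcB' hvi hv'
  have h2 : |jump μ u x| ≤ M * κ := by
    refine (abs_jump_le (hg.const_mul M) fun z => ?_).trans ?_
    · simpa using h (x + z) x
    · rw [integral_const_mul]; gcongr
  rw [e]
  calc _ ≤ |relaxed μ B c' v x| + |(c - c') * jump μ u x| := abs_add_le _ _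
    _ ≤ B * μ.real univ * (M * holderGauge β (x - y))
        + C * holderGauge β (x - y) * (M * κ) := by
        rw [abs_mul]
        gcongr
        exact (abs_nonneg _).trans hcc
    _ = _ := by ring

/-! ### A barrier principle for scalar linear equations -/

/-- For either sign, exp(lt) (m ∓ z) is nondecreasing, because m is a supersolution of z' = h - l z
and of its reflection. All later bounds in time come from a suitable choice of m. -/
theorem abs_le_of_hasDerivAt_sub_mul {T l : ℝ} {z h m m' : ℝ → ℝ} (hz : ContinuousOn z (Icc 0 T))
    (hd : ∀ t ∈ Ioo 0 T, HasDerivAt z (h t - l * z t) t) (hm : ∀ t, HasDerivAt m (m' t) t)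
    (hh : ∀ t ∈ Ioo 0 T, |h t| ≤ l * m t + m' t) (h0 : |z 0| ≤ m 0) :
    ∀ t ∈ Icc 0 T, |z t| ≤ m t := by
  have he : ∀ t, HasDerivAt (fun s => Real.exp (l * s)) (Real.exp (l * t) * l) t := fun t => by
    simpa using ((hasDerivAt_id t).const_mul l).exp
  have key : ∀ c : ℝ, |c| = 1 → ∀ t ∈ Icc 0 T, c * z t ≤ m t := by
    intro c hc t ht
    have hmono : MonotoneOn (fun s => Real.exp (l * s) * (m s - c * z s)) (Icc 0 T) := by
      refine monotoneOn_of_hasDerivWithinAt_nonneg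
        (f' := fun t => Real.exp (l * t) * (l * m t + m' t - c * h t)) (convex_Icc _ _) ?_ ?_ ?_
      · refine ContinuousOn.mul (by fun_prop) (ContinuousOn.sub ?_ (hz.const_smul c))
        exact fun s _ => (hm s).continuousAt.continuousWithinAt
      · intro s hs
        rw [interior_Icc] at hs
        refine (((he s).mul ((hm s).sub ((hd s hs).const_mul c))).congr_deriv ?_).hasDerivWithinAt
        simp only [Pi.sub_apply]
        ring
      · intro s hs
        rw [interior_Icc] at hs
        have h1 : c * h s ≤ |h s| := by
          calc c * h s ≤ |c * h s| := le_abs_self _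
            _ = |h s| := by rw [abs_mul, hc, one_mul]
        exact mul_nonneg (Real.exp_nonneg _) (by linarith [hh s hs])
    have h2 := hmono (left_mem_Icc.2 (ht.1.trans ht.2)) ht ht.1
    have h3 : c * z 0 ≤ m 0 := by
      calc c * z 0 ≤ |c * z 0| := le_abs_self _
        _ = |z 0| := by rw [abs_mul, hc, one_mul]
        _ ≤ m 0 := h0
    have h4 : 0 ≤ Real.exp (l * t) * (m t - c * z t) :=
      le_trans (mul_nonneg (Real.exp_nonneg _) (sub_nonneg.2 h3)) h2
    linarith [nonneg_of_mul_nonneg_right h4 (Real.exp_pos _)]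
  intro t ht
  rw [abs_le]
  have h1 := key 1 (by simp) t ht
  have h2 := key (-1) (by simp) t ht
  constructor <;> linarith

/-! ### Regular coefficients and the mild formulation -/

/-- Coefficients defined for all times, with values in `[0, B]`, modulus of continuity
`C (1 ∧ |z|^β)` in space, measurable in time and continuous in time on `(0, T)`. -/
structure IsRegularCoeff (T β B C : ℝ) (b : ℝ → Space d → ℝ) : Prop where
  nonneg : ∀ t x, 0 ≤ b t x
  le : ∀ t x, b t x ≤ B
  holder : ∀ t x y, |b t x - b t y| ≤ C * holderGauge β (x - y)
  measurable : ∀ x, Measurable fun t => b t x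
  continuousAt : ∀ t ∈ Ioo 0 T, ∀ x, ContinuousAt (fun s => b s x) t

theorem IsRegularCoeff.bound_nonneg {T β B C : ℝ} {b : ℝ → Space d → ℝ}
    (hb : IsRegularCoeff T β B C b) : 0 ≤ B := (hb.nonneg 0 0).trans (hb.le 0 0)

theorem continuous_of_holderGauge {β C : ℝ} (hβ : 0 < β) {u : Space d → ℝ}
    (h : ∀ x y, |u x - u y| ≤ C * holderGauge β (x - y)) : Continuous u := by
  rw [continuous_iff_continuousAt]
  intro x
  rw [ContinuousAt, tendsto_iff_norm_sub_tendsto_zero]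
  refine squeeze_zero (fun _ => norm_nonneg _) (fun y => h y x) ?_
  have : Continuous fun y : Space d => C * holderGauge β (y - x) :=
    continuous_const.mul ((continuous_holderGauge hβ.le).comp (continuous_id.sub continuous_const))
  simpa [holderGauge_zero hβ.ne'] using this.tendsto x

/-- The mild formulation, with integrating factor, of `∂_t w = b ∫ (w(x + z) - w(x)) μ(dz)`. -/
noncomputable def duhamel (μ : Measure (Space d)) (B : ℝ) (b : ℝ → Space d → ℝ) (φ : Space d → ℝ)
    (w : ℝ × Space d → ℝ) (t : ℝ) (x : Space d) : ℝ :=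
  Real.exp (-(B * μ.real univ * t)) * (φ x + ∫ s in (0 : ℝ)..t,
    Real.exp (B * μ.real univ * s) * relaxed μ B (b s x) (fun y => w (s, y)) x)

theorem duhamel_zero {μ : Measure (Space d)} {B : ℝ} {b : ℝ → Space d → ℝ} {φ : Space d → ℝ}
    (w : ℝ × Space d → ℝ) (x : Space d) : duhamel μ B b φ w 0 x = φ x := by
  simp [duhamel]

/-! ### Finite jump measures: Picard iteration and stability -/

section Picard

variable {μ : Measure (Space d)} [IsFiniteMeasure μ] {T β B C : ℝ} {b : ℝ → Space d → ℝ}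
  {φ : Space d → ℝ}

theorem integrable_slice (w : ℝ × Space d →ᵇ ℝ) (t : ℝ) (x : Space d) :
    Integrable (fun z => w (t, x + z)) μ :=
  (integrable_const ‖w‖).mono' (by fun_prop) (ae_of_all _ fun z => w.norm_coe_le_norm _)

theorem continuous_jump (w : ℝ × Space d →ᵇ ℝ) :
    Continuous fun q : ℝ × Space d => jump μ (fun y => w (q.1, y)) q.2 := by
  refine continuous_of_dominated (bound := fun _ => ‖w‖ + ‖w‖) (fun q => by fun_prop)
    (fun q => ae_of_all _ fun z => ?_) (integrable_const _) (ae_of_all _ fun z => by fun_prop)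
  exact (norm_sub_le _ _).trans (add_le_add (w.norm_coe_le_norm _) (w.norm_coe_le_norm _))

theorem continuous_relaxed (hβ : 0 < β) (hb : IsRegularCoeff T β B C b) (w : ℝ × Space d →ᵇ ℝ)
    (s : ℝ) : Continuous fun x => relaxed μ B (b s x) (fun y => w (s, y)) x := by
  have h1 : Continuous (b s) := continuous_of_holderGauge hβ (hb.holder s)
  have h2 : Continuous fun x => jump μ (fun y => w (s, y)) x :=
    (continuous_jump w).comp (by fun_prop : Continuous fun x : Space d => (s, x))
  unfold relaxed
  fun_prop

theorem measurable_relaxed (hb : IsRegularCoeff T β B C b) (w : ℝ × Space d →ᵇ ℝ)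
    (x : Space d) : Measurable fun s => relaxed μ B (b s x) (fun y => w (s, y)) x := by
  have h2 : Continuous fun s => jump μ (fun y => w (s, y)) x :=
    (continuous_jump w).comp (by fun_prop : Continuous fun s : ℝ => (s, x))
  have h3 : Continuous fun s : ℝ => B * μ.real univ * w (s, x) := by fun_prop
  exact h3.measurable.add ((hb.measurable x).mul h2.measurable)

theorem continuousAt_relaxed (hb : IsRegularCoeff T β B C b) (w : ℝ × Space d →ᵇ ℝ)
    {t : ℝ} (ht : t ∈ Ioo 0 T) (x : Space d) :
    ContinuousAt (fun s => relaxed μ B (b s x) (fun y => w (s, y)) x) t := by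
  have h2 : Continuous fun s => jump μ (fun y => w (s, y)) x :=
    (continuous_jump w).comp (by fun_prop : Continuous fun s : ℝ => (s, x))
  have h3 : Continuous fun s : ℝ => B * μ.real univ * w (s, x) := by fun_prop
  exact h3.continuousAt.add ((hb.continuousAt t ht x).mul h2.continuousAt)

theorem abs_relaxed_le_norm (hb : IsRegularCoeff T β B C b) (w : ℝ × Space d →ᵇ ℝ)
    (s : ℝ) (x : Space d) :
    |relaxed μ B (b s x) (fun y => w (s, y)) x| ≤ B * μ.real univ * ‖w‖ :=
  abs_relaxed_le (hb.nonneg s x) (hb.le s x) (integrable_slice w s x)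
    fun y => w.norm_coe_le_norm (s, y)

/-- The projection of the time axis onto `[0, T]`. -/
noncomputable def clampTime (T t : ℝ) : ℝ := max 0 (min t T)

theorem clampTime_of_mem {t : ℝ} (ht : t ∈ Icc 0 T) : clampTime T t = t := by
  rw [clampTime, min_eq_left ht.2, max_eq_right ht.1]

theorem clampTime_mem (hT : 0 ≤ T) (t : ℝ) : clampTime T t ∈ Icc 0 T :=
  ⟨le_max_left _ _, max_le hT (min_le_right _ _)⟩

theorem continuous_clampTime : Continuous (clampTime T) := by
  unfold clampTime; fun_prop

/-- Freezing time outside [0, T] gives a continuous function on all of ℝ × ℝ^d, so the iteration can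
run in the complete space of bounded continuous functions. -/
theorem continuous_duhamel (hT : 0 ≤ T) (hβ : 0 < β) (hb : IsRegularCoeff T β B C b)
    (hφ : Continuous φ) (w : ℝ × Space d →ᵇ ℝ) :
    Continuous fun q : ℝ × Space d => duhamel μ B b φ w (clampTime T q.1) q.2 := by
  have hl : 0 ≤ B * μ.real univ := mul_nonneg hb.bound_nonneg measureReal_nonneg
  have key : ∀ q : ℝ × Space d, q.1 ∈ Icc 0 T → ContinuousAt (fun p : Space d × ℝ =>
      ∫ s in (0 : ℝ)..p.2,
        Real.exp (B * μ.real univ * s) * relaxed μ B (b s p.1) (fun y => w (s, y)) p.1)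
      (q.2, q.1) := by
    intro q hq
    -- Both 0 and `q.1` must be interior to the interval of domination, hence the margin of one on
    -- each side of [0, T].
    refine intervalIntegral.continuousAt_parametric_primitive_of_dominated (μ := volume)
      (F := fun x s => Real.exp (B * μ.real univ * s) * relaxed μ B (b s x) (fun y => w (s, y)) x)
      (fun _ => Real.exp (B * μ.real univ * (T + 1)) * (B * μ.real univ * ‖w‖)) (-1) (T + 1)
      (fun x => ?_) (Eventually.of_forall fun x => ?_) intervalIntegrable_const
      (ae_of_all _ fun s => ?_) ⟨?_, ?_⟩ ⟨?_, ?_⟩ Real.volume_singleton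
    · exact (Measurable.mul (by fun_prop) (measurable_relaxed hb w x)).aestronglyMeasurable
    · refine (ae_restrict_iff' measurableSet_uIoc).2 (ae_of_all _ fun s hs => ?_)
      rw [uIoc_of_le (by linarith)] at hs
      rw [norm_mul, Real.norm_eq_abs, Real.norm_eq_abs, Real.abs_exp]
      gcongr
      · exact hs.2
      · exact abs_relaxed_le_norm hb w s x
    · exact (continuous_const.mul (continuous_relaxed hβ hb w s)).continuousAt
    all_goals linarith [hq.1, hq.2]
  have hcl := continuous_clampTime (T := T)
  refine Continuous.mul (by fun_prop) ((hφ.comp continuous_snd).add ?_)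
  rw [continuous_iff_continuousAt]
  intro q
  exact ContinuousAt.comp (x := q) (f := fun q : ℝ × Space d => (q.2, clampTime T q.1))
    (key (clampTime T q.1, q.2) (clampTime_mem hT q.1)) (by fun_prop)

theorem hasDerivAt_duhamel (hb : IsRegularCoeff T β B C b) (w : ℝ × Space d →ᵇ ℝ)
    {t : ℝ} (ht : t ∈ Ioo 0 T) (x : Space d) :
    HasDerivAt (fun s => duhamel μ B b φ w s x)
      (relaxed μ B (b t x) (fun y => w (t, y)) x - B * μ.real univ * duhamel μ B b φ w t x) t := by
  set l := B * μ.real univ with hl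
  have hm : Measurable fun s => Real.exp (l * s) * relaxed μ B (b s x) (fun y => w (s, y)) x :=
    Measurable.mul (by fun_prop) (measurable_relaxed hb w x)
  have hl0 : 0 ≤ l := mul_nonneg hb.bound_nonneg measureReal_nonneg
  have hi : IntervalIntegrable
      (fun s => Real.exp (l * s) * relaxed μ B (b s x) (fun y => w (s, y)) x) volume 0 t := by
    refine (intervalIntegrable_const (c := Real.exp (l * t) * (l * ‖w‖))).mono_fun'
      hm.aestronglyMeasurable ((ae_restrict_iff' measurableSet_uIoc).2 (ae_of_all _ fun s hs => ?_))
    rw [uIoc_of_le ht.1.le] at hs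
    beta_reduce
    rw [norm_mul, Real.norm_eq_abs, Real.norm_eq_abs, Real.abs_exp]
    gcongr
    · exact hs.2
    · exact abs_relaxed_le_norm hb w s x
  have h1 := intervalIntegral.integral_hasDerivAt_right hi
    hm.stronglyMeasurable.stronglyMeasurableAtFilter
    (ContinuousAt.mul (by fun_prop) (continuousAt_relaxed hb w ht x))
  have h2 : HasDerivAt (fun s => Real.exp (-(l * s))) (Real.exp (-(l * t)) * -l) t := by
    simpa using ((hasDerivAt_id t).const_mul l).neg.exp
  refine (h2.mul (h1.const_add (φ x))).congr_deriv ?_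
  rw [duhamel, ← hl]
  have : Real.exp (-(l * t)) * Real.exp (l * t) = 1 := by rw [← Real.exp_add]; simp
  linear_combination (relaxed μ B (b t x) (fun y => w (t, y)) x) * this

theorem continuousOn_duhamel (hT : 0 ≤ T) (hβ : 0 < β) (hb : IsRegularCoeff T β B C b)
    (hφ : Continuous φ) (w : ℝ × Space d →ᵇ ℝ) (x : Space d) :
    ContinuousOn (fun t => duhamel μ B b φ w t x) (Icc 0 T) := by
  have h := (continuous_duhamel (μ := μ) hT hβ hb hφ w).comp
    (by fun_prop : Continuous fun t : ℝ => (t, x))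
  refine h.continuousOn.congr fun t ht => ?_
  simp [clampTime_of_mem ht]

theorem abs_duhamel_le (hT : 0 ≤ T) (hβ : 0 < β) (hb : IsRegularCoeff T β B C b)
    (hφ : Continuous φ) {N : ℝ} (hN : ∀ x, |φ x| ≤ N) (w : ℝ × Space d →ᵇ ℝ) {t : ℝ}
    (ht : t ∈ Icc 0 T) (x : Space d) : |duhamel μ B b φ w t x| ≤ max N ‖w‖ := by
  have hl : 0 ≤ B * μ.real univ := mul_nonneg hb.bound_nonneg measureReal_nonneg
  refine abs_le_of_hasDerivAt_sub_mul (m := fun _ => max N ‖w‖) (m' := fun _ => 0)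
    (continuousOn_duhamel hT hβ hb hφ w x) (fun t ht => hasDerivAt_duhamel hb w ht x)
    (fun t => hasDerivAt_const _ _) (fun t _ => ?_) ?_ t ht
  · rw [add_zero]
    exact (abs_relaxed_le_norm hb w t x).trans (by gcongr; exact le_max_right _ _)
  · rw [duhamel_zero]
    exact (hN x).trans (le_max_left _ _)

theorem relaxed_sub {c : ℝ} (v w : ℝ × Space d →ᵇ ℝ) (t : ℝ) (x : Space d) :
    relaxed μ B c (fun y => v (t, y)) x - relaxed μ B c (fun y => w (t, y)) x
      = relaxed μ B c (fun y => (v - w) (t, y)) x := by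
  have h := jump_sub (μ := μ) (u := fun y => v (t, y)) (v := fun y => w (t, y)) (x := x)
    ((integrable_slice v t x).sub (integrable_const _))
    ((integrable_slice w t x).sub (integrable_const _))
  simp only [relaxed, BoundedContinuousFunction.coe_sub, Pi.sub_apply, h]
  ring

/-- The barrier is the solution of m' + l m = l · dist v w with m(0) = 0. -/
theorem abs_duhamel_sub_le (hT : 0 ≤ T) (hβ : 0 < β) (hb : IsRegularCoeff T β B C b)
    (hφ : Continuous φ) (v w : ℝ × Space d →ᵇ ℝ) {t : ℝ} (ht : t ∈ Icc 0 T) (x : Space d) :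
    |duhamel μ B b φ v t x - duhamel μ B b φ w t x|
      ≤ (1 - Real.exp (-(B * μ.real univ * t))) * dist v w := by
  set l := B * μ.real univ with hl
  refine abs_le_of_hasDerivAt_sub_mul (l := l)
    (z := fun t => duhamel μ B b φ v t x - duhamel μ B b φ w t x)
    (h := fun t => relaxed μ B (b t x) (fun y => (v - w) (t, y)) x)
    (m := fun t => (1 - Real.exp (-(l * t))) * dist v w)
    (m' := fun t => l * Real.exp (-(l * t)) * dist v w)
    ((continuousOn_duhamel hT hβ hb hφ v x).sub (continuousOn_duhamel hT hβ hb hφ w x))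
    (fun t ht => ?_) (fun t => ?_) (fun t _ => ?_) ?_ t ht
  · refine ((hasDerivAt_duhamel hb v ht x).sub (hasDerivAt_duhamel hb w ht x)).congr_deriv ?_
    rw [← relaxed_sub]
    ring
  · have h2 : HasDerivAt (fun s => Real.exp (-(l * s))) (Real.exp (-(l * t)) * -l) t := by
      simpa using ((hasDerivAt_id t).const_mul l).neg.exp
    refine ((h2.const_sub 1).mul_const (dist v w)).congr_deriv ?_
    ring
  · refine (abs_relaxed_le_norm hb (v - w) t x).trans (le_of_eq ?_)
    rw [dist_eq_norm]
    ring
  · simp [duhamel_zero]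

/-- The Picard map on bounded continuous functions. -/
noncomputable def picard (μ : Measure (Space d)) [IsFiniteMeasure μ] (hT : 0 ≤ T) (hβ : 0 < β)
    (hb : IsRegularCoeff T β B C b) (hφ : Continuous φ) {N : ℝ} (hN : ∀ x, |φ x| ≤ N)
    (w : ℝ × Space d →ᵇ ℝ) : ℝ × Space d →ᵇ ℝ :=
  BoundedContinuousFunction.ofNormedAddCommGroup
    (fun q => duhamel μ B b φ w (clampTime T q.1) q.2) (continuous_duhamel hT hβ hb hφ w)
    (max N ‖w‖) fun q => abs_duhamel_le hT hβ hb hφ hN w (clampTime_mem hT q.1) q.2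

/-- The integrating factor gives the ratio 1 - exp(-B μ(ℝ^d) T) < 1 for every T, so short time
intervals need not be glued together. -/
theorem exists_contractingWith_picard (hT : 0 ≤ T) (hβ : 0 < β) (hb : IsRegularCoeff T β B C b)
    (hφ : Continuous φ) {N : ℝ} (hN : ∀ x, |φ x| ≤ N) :
    ∃ K, ContractingWith K (picard μ hT hβ hb hφ hN) := by
  have hl : 0 ≤ B * μ.real univ := mul_nonneg hb.bound_nonneg measureReal_nonneg
  have hK : 0 ≤ 1 - Real.exp (-(B * μ.real univ * T)) := by
    rw [sub_nonneg, Real.exp_le_one_iff]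
    nlinarith
  refine ⟨Real.toNNReal (1 - Real.exp (-(B * μ.real univ * T))), ?_,
    LipschitzWith.of_dist_le_mul fun v w => ?_⟩
  · rw [Real.toNNReal_lt_one]
    simpa using Real.exp_pos _
  · rw [Real.coe_toNNReal _ hK]
    refine (BoundedContinuousFunction.dist_le (mul_nonneg hK dist_nonneg)).2 fun q => ?_
    refine (abs_duhamel_sub_le hT hβ hb hφ v w (clampTime_mem hT q.1) q.2).trans ?_
    have := (clampTime_mem hT q.1).2
    gcongr

/-- The modulus passes to the fixed point because the functions that satisfy it form a closed set
containing 0 and invariant under the Picard map. Invariance holds since m = M exp(Cκt) g(x - y)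
satisfies m' = Cκ m, which absorbs the excess in `abs_relaxed_sub_le`. -/
theorem exists_solution_of_isFiniteMeasure (μ : Measure (Space d)) [IsFiniteMeasure μ] {M κ : ℝ}
    (hT : 0 ≤ T) (hβ : 0 < β)
    (hb : IsRegularCoeff T β B C b) (hφ : Continuous φ) {N : ℝ} (hN : ∀ x, |φ x| ≤ N)
    (hM : 0 ≤ M) (hφM : ∀ x y, |φ x - φ y| ≤ M * holderGauge β (x - y))
    (hg : Integrable (holderGauge β) μ) (hκ : ∫ z, holderGauge β z ∂μ ≤ κ) :
    ∃ w : ℝ × Space d →ᵇ ℝ, (∀ t x, w (t, x) = w (clampTime T t, x)) ∧ (∀ x, w (0, x) = φ x) ∧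
      (∀ t ∈ Ioo 0 T, ∀ x,
        HasDerivAt (fun s => w (s, x)) (b t x * jump μ (fun y => w (t, y)) x) t) ∧
      ∀ t ∈ Icc 0 T, ∀ x y,
        |w (t, x) - w (t, y)| ≤ M * Real.exp (C * κ * t) * holderGauge β (x - y) := by
  obtain ⟨K, hK⟩ := exists_contractingWith_picard (μ := μ) hT hβ hb hφ hN
  set F := picard μ hT hβ hb hφ hN with hF
  have hF' : ∀ v t x, F v (t, x) = duhamel μ B b φ v (clampTime T t) x := fun _ _ _ => rfl
  set w := ContractingWith.fixedPoint F hK with hw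
  have hfix : F w = w := hK.fixedPoint_isFixedPt
  have hwd : ∀ t x, w (t, x) = duhamel μ B b φ w (clampTime T t) x := fun t x => by
    rw [← hF', hfix]
  have hwd' : ∀ t ∈ Icc 0 T, ∀ x, w (t, x) = duhamel μ B b φ w t x := fun t ht x => by
    rw [hwd, clampTime_of_mem ht]
  have h0 : (0 : ℝ) ∈ Icc 0 T := ⟨le_rfl, hT⟩
  refine ⟨w, fun t x => ?_, fun x => ?_, fun t ht x => ?_, ?_⟩
  · rw [hwd, hwd (clampTime T t), clampTime_of_mem (clampTime_mem hT t)]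
  · rw [hwd' 0 h0, duhamel_zero]
  · have h1 : (fun s => w (s, x)) =ᶠ[𝓝 t] fun s => duhamel μ B b φ w s x := by
      filter_upwards [Ioo_mem_nhds ht.1 ht.2] with s hs using hwd' s (Ioo_subset_Icc_self hs) x
    refine ((hasDerivAt_duhamel hb w ht x).congr_of_eventuallyEq h1).congr_deriv ?_
    rw [← hwd' t (Ioo_subset_Icc_self ht), relaxed]
    ring
  · set S : Set (ℝ × Space d →ᵇ ℝ) := {v | ∀ t ∈ Icc 0 T, ∀ x y,
        |v (t, x) - v (t, y)| ≤ M * Real.exp (C * κ * t) * holderGauge β (x - y)} with hS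
    have hclosed : IsClosed S := by
      simp only [hS, ofPred_forall]
      refine isClosed_iInter fun t => isClosed_iInter fun _ => isClosed_iInter fun x =>
        isClosed_iInter fun y => isClosed_le ?_ continuous_const
      exact ((continuous_eval_const _).sub
        (continuous_eval_const _)).abs
    have hzero : (0 : ℝ × Space d →ᵇ ℝ) ∈ S := by
      intro t _ x y
      have := holderGauge_nonneg β (x - y)
      simp only [BoundedContinuousFunction.coe_zero, Pi.zero_apply, sub_self, abs_zero]
      positivity
    have hmaps : MapsTo F S S := by
      intro v hv t ht x y
      rw [hF', hF', clampTime_of_mem ht]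
      refine abs_le_of_hasDerivAt_sub_mul (l := B * μ.real univ)
        (z := fun t => duhamel μ B b φ v t x - duhamel μ B b φ v t y)
        (h := fun t => relaxed μ B (b t x) (fun y => v (t, y)) x
          - relaxed μ B (b t y) (fun y => v (t, y)) y)
        (m := fun t => M * Real.exp (C * κ * t) * holderGauge β (x - y))
        (m' := fun t => C * κ * (M * Real.exp (C * κ * t) * holderGauge β (x - y)))
        ((continuousOn_duhamel hT hβ hb hφ v x).sub (continuousOn_duhamel hT hβ hb hφ v y))
        (fun t ht => ?_) (fun t => ?_) (fun t ht => ?_) ?_ t ht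
      · refine ((hasDerivAt_duhamel hb v ht x).sub (hasDerivAt_duhamel hb v ht y)).congr_deriv ?_
        ring
      · have h2 : HasDerivAt (fun s => Real.exp (C * κ * s))
            (Real.exp (C * κ * t) * (C * κ)) t := by
          simpa using ((hasDerivAt_id t).const_mul (C * κ)).exp
        refine ((h2.const_mul M).mul_const (holderGauge β (x - y))).congr_deriv ?_
        ring
      · refine (abs_relaxed_sub_le (hb.nonneg t x) (hb.le t x) (hb.nonneg t y) (hb.le t y)
          (hb.holder t x y) (fun x => integrable_slice v t x) (by positivity) hg hκ
          (fun x y => hv t (Ioo_subset_Icc_self ht) x y)).trans (le_of_eq ?_)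
        ring
      · simpa [duhamel_zero] using hφM x y
    exact hclosed.mem_of_tendsto (hK.tendsto_iterate_fixedPoint 0)
      (Eventually.of_forall fun n => hmaps.iterate n hzero)

/-- Here v solves the equation of w up to an error η. The bound does not involve μ(ℝ^d), which is
what allows solutions for different truncations of ν to be compared. -/
theorem abs_sub_le_of_hasDerivAt (hT : 0 ≤ T) (hb : IsRegularCoeff T β B C b) {η : ℝ}
    (hη : 0 ≤ η) {v w : ℝ × Space d →ᵇ ℝ} {g : ℝ → Space d → ℝ}
    (hv : ∀ t x, v (t, x) = v (clampTime T t, x)) (hw : ∀ t x, w (t, x) = w (clampTime T t, x))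
    (h0 : ∀ x, w (0, x) = v (0, x))
    (hw' : ∀ t ∈ Ioo 0 T, ∀ x,
        HasDerivAt (fun s => w (s, x)) (b t x * jump μ (fun y => w (t, y)) x) t)
    (hv' : ∀ t ∈ Ioo 0 T, ∀ x, HasDerivAt (fun s => v (s, x)) (g t x) t)
    (hg : ∀ t ∈ Ioo 0 T, ∀ x, |b t x * jump μ (fun y => v (t, y)) x - g t x| ≤ η) :
    dist w v ≤ η * T := by
  set l := B * μ.real univ with hl
  have hl0 : 0 ≤ l := mul_nonneg hb.bound_nonneg measureReal_nonneg
  have hexp : ∀ t, 0 ≤ t → 0 ≤ 1 - Real.exp (-(l * t)) := fun t ht => by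
    rw [sub_nonneg, Real.exp_le_one_iff]
    nlinarith
  set θ := 1 - Real.exp (-(l * T)) with hθ
  have hθ0 : 0 ≤ θ := hexp T hT
  have hθ1 : θ < 1 := by linarith [Real.exp_pos (-(l * T))]
  -- In place of a maximum principle on an unbounded space, the crude bound by ‖w - v‖ is improved
  -- repeatedly: inserting η t + Q into the equation returns η t + (1 - exp(-lt)) Q, and θ^k tends
  -- to 0.
  have step : ∀ k : ℕ, ∀ t ∈ Icc 0 T, ∀ x, |(w - v) (t, x)| ≤ η * t + θ ^ k * ‖w - v‖ := by
    intro k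
    induction k with
    | zero =>
      intro t ht x
      have := (w - v).norm_coe_le_norm (t, x)
      rw [Real.norm_eq_abs] at this
      linarith [mul_nonneg hη ht.1]
    | succ k ih =>
      intro t ht x
      set Q := θ ^ k * ‖w - v‖ with hQ
      have hQ0 : 0 ≤ Q := by positivity
      have key := abs_le_of_hasDerivAt_sub_mul (T := T) (l := l) (z := fun t => (w - v) (t, x))
        (h := fun t => relaxed μ B (b t x) (fun y => (w - v) (t, y)) x
          + (b t x * jump μ (fun y => v (t, y)) x - g t x))
        (m := fun t => η * t + (1 - Real.exp (-(l * t))) * Q)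
        (m' := fun t => η + l * Real.exp (-(l * t)) * Q) (by fun_prop)
        (fun t ht => ?_) (fun t => ?_) (fun t ht => ?_) ?_ t ht
      · refine key.trans ?_
        have h1 : θ ^ (k + 1) * ‖w - v‖ = θ * Q := by rw [hQ]; ring
        have h2 : Real.exp (-(l * T)) ≤ Real.exp (-(l * t)) := by
          gcongr
          exact ht.2
        rw [h1, hθ]
        gcongr
      · refine ((hw' t ht x).sub (hv' t ht x)).congr_deriv ?_
        rw [← relaxed_sub, relaxed, relaxed, BoundedContinuousFunction.coe_sub, Pi.sub_apply]
        ring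
      · have h2 : HasDerivAt (fun s => Real.exp (-(l * s))) (Real.exp (-(l * t)) * -l) t := by
          simpa using ((hasDerivAt_id t).const_mul l).neg.exp
        refine (((hasDerivAt_id t).const_mul η).add
          ((h2.const_sub 1).mul_const Q)).congr_deriv ?_
        ring
      · have h1 := abs_relaxed_le (hb.nonneg t x) (hb.le t x)
          (integrable_slice (μ := μ) (w - v) t x) (fun y => ih t (Ioo_subset_Icc_self ht) y)
        refine (abs_add_le _ _).trans ((add_le_add h1 (hg t ht x)).trans (le_of_eq ?_))
        ring
      · simp [h0]
  have hT0 : 0 ≤ η * T := by positivity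
  refine (BoundedContinuousFunction.dist_le hT0).2 fun q => ?_
  have hq : ∀ t ∈ Icc 0 T, ∀ x, |(w - v) (t, x)| ≤ η * t := fun t ht x => by
    have h1 : Tendsto (fun k : ℕ => η * t + θ ^ k * ‖w - v‖) atTop (𝓝 (η * t + 0 * ‖w - v‖)) :=
      ((tendsto_pow_atTop_nhds_zero_of_lt_one hθ0 hθ1).mul_const _).const_add _
    simpa using ge_of_tendsto' h1 fun k => step k t ht x
  obtain ⟨t, x⟩ := q
  rw [hv, hw, Real.dist_eq]
  refine (hq _ (clampTime_mem hT t) x).trans ?_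
  have := (clampTime_mem hT t).2
  gcongr

end Picard

/-! ### Truncating the Lévy measure and passing to the limit -/

theorem integrable_holderGauge {ν : Measure (Space d)} {σ β : ℝ} (hν : IsLevyMeasure ν)
    (hL : LevyGrowth ν σ) (hβ0 : 0 ≤ β) (hβ : β ∈ Ioc (2 * σ) 1) :
    Integrable (holderGauge β) ν := by
  obtain ⟨K, -, hK⟩ := hL
  have hc := continuous_holderGauge (d := d) hβ0
  refine ⟨hc.aestronglyMeasurable, ?_⟩
  rw [hasFiniteIntegral_iff_ofReal (ae_of_all _ (holderGauge_nonneg β)),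
    ← lintegral_add_compl _ (measurableSet_ball (x := (0 : Space d)) (ε := 1))]
  refine ENNReal.add_lt_top.2 ⟨?_, ?_⟩
  -- Any radius r in (0, 1) serves here: r^β ≤ 1, so dividing by it only enlarges the integrand.
  · refine lt_of_le_of_lt (lintegral_mono fun z => ?_)
      ((hK β hβ (1 / 2) ⟨by norm_num, by norm_num⟩).trans_lt ENNReal.ofReal_lt_top)
    refine ENNReal.ofReal_le_ofReal (min_le_min_left _ ?_)
    refine le_div_self (Real.rpow_nonneg (norm_nonneg z) β) (by positivity) ?_
    exact Real.rpow_le_one (by norm_num) (by norm_num) hβ0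
  · refine lt_of_le_of_lt ?_ hν.integral_lt_top
    refine (setLIntegral_mono' measurableSet_ball.compl fun z hz => ?_).trans
      (setLIntegral_le_lintegral _ _)
    have h1 : 1 ≤ ‖z‖ := by simpa using hz
    rw [min_eq_left h1]
    exact ENNReal.ofReal_le_ofReal (min_le_left _ _)

theorem measure_compl_ball_lt_top {ν : Measure (Space d)} {β r : ℝ} (hβ : 0 ≤ β) (hr : 0 < r)
    (hg : Integrable (holderGauge β) ν) : ν (Metric.ball 0 r)ᶜ < ∞ := by
  have hε : 0 < min 1 (r ^ β) := lt_min one_pos (Real.rpow_pos_of_pos hr β)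
  refine (measure_mono fun z hz => ?_).trans_lt (hg.measure_ge_lt_top hε)
  have h1 : r ≤ ‖z‖ := by simpa using hz
  exact min_le_min_left _ (Real.rpow_le_rpow hr.le h1 hβ)

/-- The balls shrink to the origin, where the gauge itself vanishes. -/
theorem tendsto_setIntegral_ball {ν : Measure (Space d)} {β : ℝ} (hβ : 0 < β)
    (hg : Integrable (holderGauge β) ν) :
    Tendsto (fun n : ℕ => ∫ z in Metric.ball 0 (1 / ((n : ℝ) + 1)), holderGauge β z ∂ν) atTop
      (𝓝 0) := by
  have h := tendsto_setIntegral_of_antitone (μ := ν) (f := holderGauge β)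
    (s := fun n : ℕ => Metric.ball (0 : Space d) (1 / ((n : ℝ) + 1)))
    (fun n => measurableSet_ball)
    (fun m n hmn => Metric.ball_subset_ball (one_div_le_one_div_of_le (by positivity) (by gcongr)))
    ⟨0, hg.integrableOn⟩
  rwa [setIntegral_eq_zero_of_forall_eq_zero fun z hz => ?_] at h
  rw [mem_iInter] at hz
  have h1 : ‖z‖ ≤ 0 := ge_of_tendsto' tendsto_one_div_add_atTop_nhds_zero_nat fun n => by
    have := hz n
    rw [mem_ball_zero_iff] at this
    exact this.le
  rw [norm_le_zero_iff.1 h1, holderGauge_zero hβ.ne']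

theorem integrable_increment {ν : Measure (Space d)} {β M : ℝ} {u : Space d → ℝ}
    (hu : Continuous u) (hg : Integrable (holderGauge β) ν)
    (hM : ∀ x y, |u x - u y| ≤ M * holderGauge β (x - y)) (x : Space d) :
    Integrable (fun z => u (x + z) - u x) ν := by
  refine (hg.const_mul M).mono' (by fun_prop) (ae_of_all _ fun z => ?_)
  simpa using hM (x + z) x

theorem abs_jump_restrict_sub_le {ν : Measure (Space d)} {β M r : ℝ} {u : Space d → ℝ}
    (hu : Continuous u) (hg : Integrable (holderGauge β) ν)
    (hM : ∀ x y, |u x - u y| ≤ M * holderGauge β (x - y)) (x : Space d) :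
    |jump (ν.restrict (Metric.ball 0 r)ᶜ) u x - jump ν u x|
      ≤ M * ∫ z in Metric.ball 0 r, holderGauge β z ∂ν := by
  have h1 := integral_add_compl (measurableSet_ball (x := (0 : Space d)) (ε := r))
    (integrable_increment hu hg hM x)
  have h2 : jump (ν.restrict (Metric.ball 0 r)ᶜ) u x - jump ν u x
      = -jump (ν.restrict (Metric.ball 0 r)) u x := by
    rw [jump, jump, jump, ← h1]
    ring
  rw [h2, abs_neg, ← integral_const_mul]
  exact abs_jump_le (hg.const_mul M).restrict fun z => by simpa using hM (x + z) x

/-- A classical solution of the dual equation, Hölder continuous in space. -/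
theorem exists_classical_solution {ν : Measure (Space d)} {T β B C M N : ℝ}
    {b : ℝ → Space d → ℝ} {φ : Space d → ℝ} (hT : 0 ≤ T) (hβ : 0 < β)
    (hb : IsRegularCoeff T β B C b) (hC : 0 ≤ C) (hφ : Continuous φ) (hN : ∀ x, |φ x| ≤ N)
    (hM : 0 ≤ M) (hφM : ∀ x y, |φ x - φ y| ≤ M * holderGauge β (x - y))
    (hg : Integrable (holderGauge β) ν) :
    ∃ (w : ℝ × Space d →ᵇ ℝ) (M' : ℝ), 0 ≤ M' ∧ (∀ x, w (0, x) = φ x) ∧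
      (∀ t ∈ Ioo 0 T, ∀ x,
        HasDerivAt (fun s => w (s, x)) (b t x * jump ν (fun y => w (t, y)) x) t) ∧
      ∀ t ∈ Icc 0 T, ∀ x y, |w (t, x) - w (t, y)| ≤ M' * holderGauge β (x - y) := by
  obtain ⟨κ, hκ⟩ : ∃ κ, ∫ z, holderGauge β z ∂ν = κ := ⟨_, rfl⟩
  have hκ0 : 0 ≤ κ := hκ ▸ integral_nonneg (holderGauge_nonneg β)
  obtain ⟨M', hM'⟩ : ∃ M', M' = M * Real.exp (C * κ * T) := ⟨_, rfl⟩
  have hM'0 : 0 ≤ M' := hM' ▸ mul_nonneg hM (Real.exp_nonneg _)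
  -- The measures are ν outside the ball of radius 1/(n + 1), and ε n is the gauge integral over
  -- that ball; only the listed properties matter afterwards.
  obtain ⟨μ, ε, hμfin, hμg, hμκ, hμjump, hε0, hεlim, hεanti⟩ :
      ∃ (μ : ℕ → Measure (Space d)) (ε : ℕ → ℝ), (∀ n, IsFiniteMeasure (μ n)) ∧
        (∀ n, Integrable (holderGauge β) (μ n)) ∧ (∀ n, ∫ z, holderGauge β z ∂(μ n) ≤ κ) ∧
        (∀ (n : ℕ) (M : ℝ) (u : Space d → ℝ), Continuous u →
          (∀ x y, |u x - u y| ≤ M * holderGauge β (x - y)) →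
            ∀ x, |jump (μ n) u x - jump ν u x| ≤ M * ε n) ∧
        (∀ n, 0 ≤ ε n) ∧ Tendsto ε atTop (𝓝 0) ∧ Antitone ε := by
    refine ⟨fun n => ν.restrict (Metric.ball 0 (1 / ((n : ℝ) + 1)))ᶜ,
      fun n => ∫ z in Metric.ball 0 (1 / ((n : ℝ) + 1)), holderGauge β z ∂ν,
      fun n => ⟨?_⟩, fun n => hg.restrict,
      fun n => hκ ▸ setIntegral_le_integral hg (ae_of_all _ (holderGauge_nonneg β)),
      fun n M u hu hM x => abs_jump_restrict_sub_le hu hg hM x,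
      fun n => integral_nonneg (holderGauge_nonneg β), tendsto_setIntegral_ball hβ hg,
      fun m n hmn => setIntegral_mono_set hg.integrableOn (ae_of_all _ (holderGauge_nonneg β))
        (Metric.ball_subset_ball (one_div_le_one_div_of_le ?_ ?_)).eventuallyLE⟩
    · rw [Measure.restrict_apply_univ]
      exact measure_compl_ball_lt_top hβ.le (by positivity) hg
    · positivity
    · gcongr
  choose w hwcl hw0 hwd hwH using fun n => exists_solution_of_isFiniteMeasure (μ n) (κ := κ)
    hT hβ hb hφ hN hM hφM (hμg n)
    (hμκ n)
  have hH : ∀ n, ∀ t ∈ Icc 0 T, ∀ x y,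
      |w n (t, x) - w n (t, y)| ≤ M' * holderGauge β (x - y) := fun n t ht x y => by
    refine (hwH n t ht x y).trans ?_
    have h1 := holderGauge_nonneg β (x - y)
    have h2 := ht.2
    rw [hM']
    gcongr
  have hB := hb.bound_nonneg
  have hcont : ∀ (v : ℝ × Space d →ᵇ ℝ) (t : ℝ), Continuous fun y => v (t, y) :=
    fun v t => by fun_prop
  -- `w m` solves the equation for `μ n` up to the change of measure; passing through ν costs M' ε n
  -- + M' ε m.
  have hdist : ∀ n m, dist (w n) (w m) ≤ B * (M' * (ε n + ε m)) * T := by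
    intro n m
    refine abs_sub_le_of_hasDerivAt (μ := μ n) hT hb
      (mul_nonneg hB (mul_nonneg hM'0 (add_nonneg (hε0 n) (hε0 m)))) (hwcl m) (hwcl n)
      (fun x => by rw [hw0, hw0]) (hwd n) (hwd m) fun t ht x => ?_
    have ht' := Ioo_subset_Icc_self ht
    rw [← mul_sub, abs_mul, abs_of_nonneg (hb.nonneg t x)]
    have h1 := hμjump n M' _ (hcont (w m) t) (hH m t ht') x
    have h2 := hμjump m M' _ (hcont (w m) t) (hH m t ht') x
    have h3 := abs_sub_le (jump (μ n) (fun y => w m (t, y)) x) (jump ν (fun y => w m (t, y)) x)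
      (jump (μ m) (fun y => w m (t, y)) x)
    rw [abs_sub_comm (jump ν _ x)] at h3
    refine mul_le_mul (hb.le t x) (h3.trans ?_) (abs_nonneg _) hB
    rw [mul_add]
    exact add_le_add h1 h2
  have hcauchy : CauchySeq w := by
    refine cauchySeq_of_le_tendsto_0 (fun n => B * (M' * (ε n + ε n)) * T)
      (fun n m k hn hm => (hdist n m).trans ?_) ?_
    · have h1 := hεanti hn
      have h2 := hεanti hm
      gcongr
    · have := (((hεlim.add hεlim).const_mul M').const_mul B).mul_const T
      simpa using this
  obtain ⟨w', hw'⟩ := cauchySeq_tendsto_of_complete hcauchy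
  have hpt : ∀ q, Tendsto (fun n => w n q) atTop (𝓝 (w' q)) := fun q =>
    ((continuous_eval_const q).tendsto w').comp hw'
  have hH' : ∀ t ∈ Icc 0 T, ∀ x y, |w' (t, x) - w' (t, y)| ≤ M' * holderGauge β (x - y) :=
    fun t ht x y => le_of_tendsto' ((hpt (t, x)).sub (hpt (t, y))).abs fun n => hH n t ht x y
  refine ⟨w', M', hM'0, fun x => ?_, fun t ht x => ?_, hH'⟩
  · refine tendsto_nhds_unique (hpt (0, x)) ?_
    simp [hw0]
  -- Uniform convergence alone does not control jumps under an infinite ν. The increments of w n -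
  -- w' are bounded by 2 dist and, through the common modulus, by 2 M' g; dominated convergence then
  -- gives a rate independent of time and position, as needed to differentiate the limit.
  · set ρ : ℕ → ℝ := fun n => ∫ z, min (2 * dist (w n) w') (2 * M' * holderGauge β z) ∂ν with hρ
    have hgc := continuous_holderGauge (d := d) hβ.le
    have hρnn : ∀ n (z : Space d), 0 ≤ min (2 * dist (w n) w') (2 * M' * holderGauge β z) :=
      fun n z =>
      le_min (mul_nonneg zero_le_two dist_nonneg)
        (mul_nonneg (mul_nonneg zero_le_two hM'0) (holderGauge_nonneg β z))
    have hρb : ∀ n (z : Space d), ‖min (2 * dist (w n) w') (2 * M' * holderGauge β z)‖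
        ≤ 2 * M' * holderGauge β z := fun n z => by
      rw [Real.norm_of_nonneg (hρnn n z)]
      exact min_le_right _ _
    have hρi : ∀ n, Integrable (fun z => min (2 * dist (w n) w') (2 * M' * holderGauge β z)) ν :=
      fun n => (hg.const_mul (2 * M')).mono' (by fun_prop) (ae_of_all _ (hρb n))
    have hρlim : Tendsto ρ atTop (𝓝 0) := by
      rw [← integral_zero (Space d) ℝ (μ := ν)]
      refine tendsto_integral_of_dominated_convergence (fun z => 2 * M' * holderGauge β z)
        (fun n => (hρi n).aestronglyMeasurable) (hg.const_mul _) (fun n => ae_of_all _ (hρb n))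
        (ae_of_all _ fun z => ?_)
      refine squeeze_zero (fun n => hρnn n z) (fun n => min_le_left _ _) ?_
      simpa using (tendsto_iff_dist_tendsto_zero.1 hw').const_mul 2
    refine hasDerivAt_of_tendstoUniformlyOn (f := fun n s => w n (s, x)) isOpen_Ioo
      (g' := fun t => b t x * jump ν (fun y => w' (t, y)) x) ?_
      (Eventually.of_forall fun n t ht => hwd n t ht x) (fun t _ => hpt (t, x)) ht
    rw [Metric.tendstoUniformlyOn_iff]
    intro η hη
    have hlim : Tendsto (fun n => B * (M' * ε n + ρ n)) atTop (𝓝 0) := by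
      simpa using ((hεlim.const_mul M').add hρlim).const_mul B
    filter_upwards [hlim.eventually_lt_const hη] with n hn s hs
    refine lt_of_le_of_lt ?_ hn
    have hs' := Ioo_subset_Icc_self hs
    rw [dist_comm, Real.dist_eq, ← mul_sub, abs_mul, abs_of_nonneg (hb.nonneg s x)]
    have h1 := hμjump n M' _ (hcont (w n) s) (hH n s hs') x
    have h2 : |jump ν (fun y => w n (s, y)) x - jump ν (fun y => w' (s, y)) x| ≤ ρ n := by
      rw [← jump_sub (integrable_increment (hcont (w n) s) hg (hH n s hs') x)
        (integrable_increment (hcont w' s) hg (hH' s hs') x)]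
      refine abs_jump_le (hρi n) fun z => le_min ?_ ?_
      · have e1 := BoundedContinuousFunction.dist_coe_le_dist (f := w n) (g := w') (s, x + z)
        have e2 := BoundedContinuousFunction.dist_coe_le_dist (f := w n) (g := w') (s, x)
        rw [Real.dist_eq] at e1 e2
        have := abs_sub (w n (s, x + z) - w' (s, x + z)) (w n (s, x) - w' (s, x))
        linarith
      · have e1 := hH n s hs' (x + z) x
        have e2 := hH' s hs' (x + z) x
        rw [add_sub_cancel_left] at e1 e2
        have := abs_sub (w n (s, x + z) - w n (s, x)) (w' (s, x + z) - w' (s, x))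
        rw [sub_sub_sub_comm] at this
        linarith
    refine mul_le_mul (hb.le s x) ?_ (abs_nonneg _) hB
    exact (abs_sub_le _ _ _).trans (add_le_add h1 h2)

/-! ### Hölder norms and the gauge -/

/-- The seminorm only sees pairs at distance less than one; for the others the oscillation is at
most 2 N and the gauge equals 1. -/
theorem abs_sub_le_holderGauge {β M N : ℝ} {u : Space d → ℝ} (hN : ∀ x, |u x| ≤ N)
    (hβ : 0 ≤ β) (hM : 0 ≤ M) (hu : holderSeminorm β u ≤ ENNReal.ofReal M) (x y : Space d) :
    |u x - u y| ≤ (M + 2 * N) * holderGauge β (x - y) := by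
  have hN0 : 0 ≤ N := (abs_nonneg _).trans (hN 0)
  rcases lt_or_ge ‖x - y‖ 1 with h | h
  · rcases eq_or_ne x y with rfl | hxy
    · have := holderGauge_nonneg β (x - x)
      simp only [sub_self, abs_zero] at this ⊢
      positivity
    · have hpos : 0 < ‖x - y‖ ^ β := Real.rpow_pos_of_pos (norm_pos_iff.2 (sub_ne_zero.2 hxy)) β
      have hy : y ∈ Metric.ball x 1 \ {x} := ⟨by rwa [Metric.mem_ball, dist_comm, dist_eq_norm],
        hxy.symm⟩
      have h1 : ENNReal.ofReal (|u x - u y| / ‖x - y‖ ^ β) ≤ ENNReal.ofReal M :=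
        (le_iSup_of_le x (le_iSup₂_of_le (f := fun y _ => ENNReal.ofReal
          (|u x - u y| / ‖x - y‖ ^ β)) y hy le_rfl)).trans hu
      rw [ENNReal.ofReal_le_ofReal_iff hM, div_le_iff₀ hpos] at h1
      have h2 : holderGauge β (x - y) = ‖x - y‖ ^ β :=
        min_eq_right (Real.rpow_le_one (norm_nonneg _) h.le hβ)
      rw [h2]
      nlinarith
  · have h3 : holderGauge β (x - y) = 1 := min_eq_left (Real.one_le_rpow h hβ)
    have := abs_sub (u x) (u y)
    rw [h3]
    linarith [hN x, hN y]

/-- Extension by zero outside (0, T) keeps the sign, the bounds and the spatial modulus. Continuity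
in time may fail at 0 and T, but measurability survives, and the Duhamel integral needs no more
there. -/
theorem isRegularCoeff_indicator {T β : ℝ} {b : ℝ → Space d → ℝ} (hβ : 0 < β)
    (hb : IsAdmissibleCoeff T β b) :
    ∃ B C, 0 ≤ C ∧
      IsRegularCoeff T β B C (fun t x => (Ioo 0 T).indicator (fun s => b s x) t) := by
  obtain ⟨B, hB, hr⟩ := hb.range
  have hfin := hb.holder
  rw [MemBoundedHolder] at hfin
  obtain ⟨L, hL⟩ : ∃ L : ℝ≥0∞, L = ⨆ t ∈ Ioo 0 T, holderNorm β (b t) := ⟨_, rfl⟩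
  have hLM : L = ENNReal.ofReal L.toReal := (ENNReal.ofReal_toReal (hL ▸ hfin.ne)).symm
  have hsemi : ∀ t ∈ Ioo 0 T, holderSeminorm β (b t) ≤ ENNReal.ofReal L.toReal := by
    intro t ht
    rw [← hLM, hL]
    exact le_add_self.trans (le_iSup₂ (f := fun t (_ : t ∈ Ioo 0 T) => holderNorm β (b t)) t ht)
  have habs : ∀ t ∈ Ioo 0 T, ∀ x, |b t x| ≤ B := fun t ht x => by
    rw [abs_of_nonneg (hr t ht x).1]
    exact (hr t ht x).2
  have hC : 0 ≤ L.toReal + 2 * B := by positivity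
  have hcont : ∀ x, ContinuousOn (fun s => b s x) (Ioo 0 T) := fun x =>
    ContinuousOn.comp (g := fun q : ℝ × Space d => b q.1 q.2) hb.continuousOn
      (f := fun s : ℝ => (s, x)) (by fun_prop) fun s hs => ⟨hs, mem_univ _⟩
  refine ⟨B, L.toReal + 2 * B, hC, ⟨fun t x => ?_, fun t x => ?_, fun t x y => ?_, fun x => ?_,
    fun t ht x => ?_⟩⟩
  · exact indicator_apply_nonneg fun ht => (hr t ht x).1
  · exact indicator_apply_le' (fun ht => (hr t ht x).2) fun _ => hB
  · by_cases ht : t ∈ Ioo 0 T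
    · simp only [indicator_of_mem ht]
      exact abs_sub_le_holderGauge (habs t ht) hβ.le ENNReal.toReal_nonneg (hsemi t ht) x y
    · have := holderGauge_nonneg β (x - y)
      simp only [indicator_of_notMem ht, sub_self, abs_zero]
      positivity
  · rw [← piecewise_eq_indicator]
    exact (hcont x).measurable_piecewise continuousOn_const measurableSet_Ioo
  · refine ((hcont x).continuousAt (Ioo_mem_nhds ht.1 ht.2)).congr ?_
    filter_upwards [Ioo_mem_nhds ht.1 ht.2] with s hs
    rw [indicator_of_mem hs]

theorem memBoundedHolder_of_le {T α β M N : ℝ} {w : ℝ → Space d → ℝ} (hα : α ≤ β) (hM : 0 ≤ M)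
    (hN : ∀ t x, |w t x| ≤ N)
    (hw : ∀ t ∈ Ioo 0 T, ∀ x y, |w t x - w t y| ≤ M * holderGauge β (x - y)) :
    MemBoundedHolder T α w := by
  refine lt_of_le_of_lt (b := ENNReal.ofReal N + ENNReal.ofReal M) (iSup₂_le fun t ht => ?_)
    (ENNReal.add_lt_top.2 ⟨ENNReal.ofReal_lt_top, ENNReal.ofReal_lt_top⟩)
  refine add_le_add (iSup_le fun x => ENNReal.ofReal_le_ofReal (hN t x))
    (iSup_le fun x => iSup₂_le fun y hy => ENNReal.ofReal_le_ofReal ?_)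
  have hpos : 0 < ‖x - y‖ := norm_pos_iff.2 (sub_ne_zero.2 fun h => hy.2 h.symm)
  have hlt : ‖x - y‖ < 1 := by
    rw [← dist_eq_norm, dist_comm]
    exact hy.1
  rw [div_le_iff₀ (Real.rpow_pos_of_pos hpos α)]
  refine (hw t ht x y).trans (mul_le_mul_of_nonneg_left ((min_le_right _ _).trans ?_) hM)
  exact Real.rpow_le_rpow_of_exponent_ge hpos hlt.le hα

theorem exists_holderGauge_bound {β : ℝ} {φ : Space d → ℝ} (hβ : 0 ≤ β) (hβ1 : β ≤ 1)
    (hφ : IsC1Bounded φ) :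
    ∃ M, 0 ≤ M ∧ ∀ x y, |φ x - φ y| ≤ M * holderGauge β (x - y) := by
  obtain ⟨D, hD⟩ := hφ.deriv_bounded
  obtain ⟨N, hN⟩ := hφ.bounded
  have hD0 : 0 ≤ D := (norm_nonneg _).trans (hD 0)
  have hN0 : 0 ≤ N := (abs_nonneg _).trans (hN 0)
  refine ⟨D + 2 * N, by positivity, fun x y => ?_⟩
  have h1 : |φ x - φ y| ≤ D * ‖x - y‖ := by
    have := Convex.norm_image_sub_le_of_norm_fderiv_le (𝕜 := ℝ) (f := φ) (s := univ)
      (fun z _ => (hφ.contDiff.differentiable one_ne_zero).differentiableAt)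
      (fun z _ => hD z) convex_univ (mem_univ y) (mem_univ x)
    simpa using this
  have h2 : |φ x - φ y| ≤ 2 * N := by
    have := abs_sub (φ x) (φ y)
    linarith [hN x, hN y]
  rcases le_total ‖x - y‖ 1 with h | h
  · have h3 : ‖x - y‖ ≤ ‖x - y‖ ^ β := by
      simpa using Real.rpow_le_rpow_of_exponent_ge_of_imp (norm_nonneg (x - y)) h hβ1
        (fun h0 h1 => absurd h1 one_ne_zero)
    have h4 : ‖x - y‖ ≤ holderGauge β (x - y) := le_min h h3
    nlinarith [holderGauge_nonneg β (x - y)]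
  · have h3 : holderGauge β (x - y) = 1 := min_eq_left (Real.one_le_rpow h hβ)
    rw [h3]
    linarith

/-! ### From classical to viscosity solutions -/

theorem integrable_norm_ball {ν : Measure (Space d)} (hν : IsLevyMeasure ν) {r : ℝ} (hr : r ≤ 1) :
    IntegrableOn (fun z => ‖z‖) (Metric.ball 0 r) ν := by
  have h : Integrable (fun z : Space d => min 1 ‖z‖) ν := by
    refine ⟨by fun_prop, ?_⟩
    rw [hasFiniteIntegral_iff_ofReal (ae_of_all _ fun z => by positivity)]
    exact hν.integral_lt_top
  refine h.integrableOn.congr_fun (fun z hz => ?_) measurableSet_ball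
  rw [mem_ball_zero_iff] at hz
  exact min_eq_right (hz.le.trans hr)

/-- A C¹ function is Lipschitz on the closed unit ball around x, and ν integrates |z| near the
origin because it has order less than one. -/
theorem integrableOn_increment_of_contDiff {ν : Measure (Space d)} (hν : IsLevyMeasure ν) {r : ℝ}
    (hr : r ≤ 1) {ψ : Space d → ℝ} (hψ : ContDiff ℝ 1 ψ) (x : Space d) :
    IntegrableOn (fun z => ψ (x + z) - ψ x) (Metric.ball 0 r) ν := by
  obtain ⟨D, hD⟩ := (isCompact_closedBall x 1).exists_bound_of_continuousOn
    (hψ.continuous_fderiv one_ne_zero).continuousOn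
  have hc := hψ.continuous
  refine ((integrable_norm_ball hν hr).const_mul D).mono' (by fun_prop) ?_
  refine (ae_restrict_iff' measurableSet_ball).2 (ae_of_all _ fun z hz => ?_)
  rw [mem_ball_zero_iff] at hz
  have := Convex.norm_image_sub_le_of_norm_fderiv_le (𝕜 := ℝ) (f := ψ)
    (s := Metric.closedBall x 1)
    (fun z _ => (hψ.differentiable one_ne_zero).differentiableAt)
    (fun z hz => hD z hz) (convex_closedBall x 1) (Metric.mem_closedBall_self zero_le_one)
    (show x + z ∈ Metric.closedBall x 1 by simpa using hz.le.trans hr)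
  simpa using this

theorem IsTestFunction.contDiff_slice {T : ℝ} {ψ : ℝ → Space d → ℝ} (hψ : IsTestFunction T ψ)
    {t : ℝ} (ht : t ∈ Ioo 0 T) : ContDiff ℝ 1 (ψ t) := by
  rw [← contDiffOn_univ]
  exact ContDiffOn.comp (g := fun q : ℝ × Space d => ψ q.1 q.2) hψ
    (f := fun x : Space d => (t, x)) (by fun_prop) fun x _ => ⟨ht, mem_univ _⟩

theorem IsTestFunction.differentiableAt {T : ℝ} {ψ : ℝ → Space d → ℝ} (hψ : IsTestFunction T ψ)
    {t : ℝ} (ht : t ∈ Ioo 0 T) (x : Space d) : DifferentiableAt ℝ (fun s => ψ s x) t := by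
  have h1 : DifferentiableAt ℝ (fun q : ℝ × Space d => ψ q.1 q.2) (t, x) :=
    (hψ.differentiableOn one_ne_zero).differentiableAt
      ((isOpen_Ioo.prod isOpen_univ).mem_nhds ⟨ht, mem_univ _⟩)
  exact DifferentiableAt.comp t (f := fun s : ℝ => (s, x)) h1 (by fun_prop)

theorem levyOuter_add_levyInner {ν : Measure (Space d)} {u : Space d → ℝ} {x : Space d} {r : ℝ}
    (hu : Integrable (fun z => u (x + z) - u x) ν) :
    levyOuter ν r u x + levyInner ν r u x = jump ν u x := by
  rw [add_comm]
  exact integral_add_compl measurableSet_ball hu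

/-- Classical solutions are viscosity solutions. -/
theorem isDualViscositySolution_of_hasDerivAt {ν : Measure (Space d)} (hν : IsLevyMeasure ν)
    {T β M : ℝ} {b : ℝ → Space d → ℝ} {φ : Space d → ℝ} {w : ℝ × Space d →ᵇ ℝ}
    (hb : ∀ t ∈ Ioo 0 T, ∀ x, 0 ≤ b t x) (h0 : ∀ x, w (0, x) = φ x)
    (hw : ∀ t ∈ Ioo 0 T, ∀ x,
      HasDerivAt (fun s => w (s, x)) (b t x * jump ν (fun y => w (t, y)) x) t)
    (hg : Integrable (holderGauge β) ν)
    (hM : ∀ t ∈ Icc 0 T, ∀ x y, |w (t, x) - w (t, y)| ≤ M * holderGauge β (x - y)) :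
    IsDualViscositySolution ν T b φ fun t x => w (t, x) := by
  have hbdd : BoundedOnStrip T fun t x => w (t, x) :=
    ⟨‖w‖, fun t _ x => w.norm_coe_le_norm (t, x)⟩
  have hint : ∀ t ∈ Ioo 0 T, ∀ x, Integrable (fun z => w (t, x + z) - w (t, x)) ν :=
    fun t ht x => integrable_increment (u := fun y => w (t, y)) (by fun_prop) hg
      (hM t (Ioo_subset_Icc_self ht)) x
  -- At an extremum in time with x fixed, ψ and w have the same time derivative, so the viscosity
  -- inequality reduces to a comparison of the inner integrals.
  have hderiv : ∀ ψ : ℝ → Space d → ℝ, IsTestFunction T ψ → ∀ t ∈ Ioo 0 T, ∀ x,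
      IsLocalExtr (fun s => w (s, x) - ψ s x) t →
        deriv (fun s => ψ s x) t = b t x * jump ν (fun y => w (t, y)) x := by
    intro ψ hψ t ht x he
    have := he.hasDerivAt_eq_zero ((hw t ht x).sub (hψ.differentiableAt ht x).hasDerivAt)
    linarith
  refine ⟨⟨hbdd, ?_, fun x => (h0 x).le, ?_⟩, ⟨hbdd, ?_, fun x => (h0 x).ge, ?_⟩⟩
  · exact w.continuous.upperSemicontinuous.upperSemicontinuousOn _
  · intro r hr ψ hψ t ht x hmax
    have he : IsLocalMax (fun s => w (s, x) - ψ s x) t := by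
      filter_upwards [Ioo_mem_nhds ht.1 ht.2] with s hs
      exact hmax (show (s, x) ∈ _ from ⟨hs, trivial⟩)
    -- At a maximum of w - ψ, each increment of w in space is at most that of ψ.
    have hle : levyInner ν r (fun y => w (t, y)) x ≤ levyInner ν r (ψ t) x := by
      refine setIntegral_mono (hint t ht x).integrableOn
        (integrableOn_increment_of_contDiff hν hr.2.le (hψ.contDiff_slice ht) x) fun z => ?_
      have := hmax (show (t, x + z) ∈ Ioo 0 T ×ˢ univ from ⟨ht, trivial⟩)
      simp only [mem_ofPred_eq] at this
      simp only
      linarith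
    rw [hderiv ψ hψ t ht x (Or.inr he), ← levyOuter_add_levyInner (r := r) (hint t ht x),
      ← mul_sub]
    exact mul_nonpos_of_nonneg_of_nonpos (hb t ht x) (by linarith)
  · exact w.continuous.lowerSemicontinuous.lowerSemicontinuousOn _
  · intro r hr ψ hψ t ht x hmin
    have he : IsLocalMin (fun s => w (s, x) - ψ s x) t := by
      filter_upwards [Ioo_mem_nhds ht.1 ht.2] with s hs
      exact hmin (show (s, x) ∈ _ from ⟨hs, trivial⟩)
    have hle : levyInner ν r (ψ t) x ≤ levyInner ν r (fun y => w (t, y)) x := by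
      refine setIntegral_mono
        (integrableOn_increment_of_contDiff hν hr.2.le (hψ.contDiff_slice ht) x)
        (hint t ht x).integrableOn fun z => ?_
      have := hmin (show (t, x + z) ∈ Ioo 0 T ×ˢ univ from ⟨ht, trivial⟩)
      simp only [mem_ofPred_eq] at this
      simp only
      linarith
    rw [hderiv ψ hψ t ht x (Or.inl he), ← levyOuter_add_levyInner (r := r) (hint t ht x),
      ← mul_sub]
    exact mul_nonneg (hb t ht x) (by linarith)

/-- Existence and Hölder regularity, without loss of the exponent `β` of the coefficient. -/
theorem exists_isDualViscositySolution {T σ α β : ℝ} (hT : 0 < T) (hσ : 0 ≤ 2 * σ)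
    {ν : Measure (Space d)} (hν : IsLevyMeasure ν) (hL : LevyGrowth ν σ)
    {b : ℝ → Space d → ℝ} (hb : IsAdmissibleCoeff T β b) {φ : Space d → ℝ} (hφ : IsC1Bounded φ)
    (hβ : β ∈ Ioc (2 * σ) 1) (hα : α ≤ β) :
    ∃ w : ℝ → Space d → ℝ, IsDualViscositySolution ν T b φ w ∧ MemBoundedHolder T α w := by
  have hβ0 : 0 < β := hσ.trans_lt hβ.1
  have hg := integrable_holderGauge hν hL hβ0.le hβ
  obtain ⟨B, C, hC, hreg⟩ := isRegularCoeff_indicator hβ0 hb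
  obtain ⟨M, hM, hφM⟩ := exists_holderGauge_bound hβ0.le hβ.2 hφ
  obtain ⟨N, hN⟩ := hφ.bounded
  obtain ⟨w, M', hM', h0, hw, hwM⟩ :=
    exists_classical_solution hT.le hβ0 hreg hC hφ.contDiff.continuous hN hM hφM hg
  refine ⟨fun t x => w (t, x), isDualViscositySolution_of_hasDerivAt hν ?_ h0
    (fun t ht x => ?_) hg hwM, memBoundedHolder_of_le hα hM'
      (fun t x => w.norm_coe_le_norm (t, x)) fun t ht => hwM t (Ioo_subset_Icc_self ht)⟩
  · obtain ⟨B', -, hB'⟩ := hb.range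
    exact fun t ht x => (hB' t ht x).1
  · simpa [indicator_of_mem ht] using hw t ht x

end DegenerateDual

theorem mainTheorem3 (d : ℕ) (T : ℝ) (hT : 0 < T) (σ : ℝ) (hσ : 2 * σ ∈ Set.Ioo (0 : ℝ) (1 / 2))
    (ν : MeasureTheory.Measure (DegenerateDual.Space d))
    (hν : DegenerateDual.IsLevyMeasure ν) (hL : DegenerateDual.LevyGrowth ν σ)
    (β : ℝ) (b : ℝ → DegenerateDual.Space d → ℝ)
    (hb : DegenerateDual.IsAdmissibleCoeff T β b)
    (φ : DegenerateDual.Space d → ℝ) (hφ : DegenerateDual.IsC1Bounded φ) :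
    (β ∈ Set.Ioc (2 * σ / (1 - 2 * σ)) 1 →
      ∃ w : ℝ → DegenerateDual.Space d → ℝ,
        DegenerateDual.IsDualViscositySolution ν T b φ w ∧
        DegenerateDual.MemBoundedHolder T (β - 2 * σ / (1 - 2 * σ)) w) ∧
    (DegenerateDual.IsSymmetricAtOrigin ν → β ∈ Set.Ioc (2 * σ / (1 - σ)) 1 →
      ∃ w : ℝ → DegenerateDual.Space d → ℝ,
        DegenerateDual.IsDualViscositySolution ν T b φ w ∧
        DegenerateDual.MemBoundedHolder T (β - 2 * σ / (1 - σ)) w) := by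
  obtain ⟨h0, h1⟩ := hσ
  -- The two thresholds are 2σ/s with s = 1 - 2σ and s = 1 - σ. As 0 < s ≤ 1, β > 2σ/s forces β >
  -- 2σ, and the target exponent β - 2σ/s is at most β.
  have key : ∀ s, 0 < s → s ≤ 1 → β ∈ Set.Ioc (2 * σ / s) 1 →
      ∃ w : ℝ → DegenerateDual.Space d → ℝ,
        DegenerateDual.IsDualViscositySolution ν T b φ w ∧
        DegenerateDual.MemBoundedHolder T (β - 2 * σ / s) w := by
    intro s hs hs1 hβ
    exact DegenerateDual.exists_isDualViscositySolution hT h0.le hν hL hb hφ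
      ⟨(le_div_self h0.le hs hs1).trans_lt hβ.1, hβ.2⟩ (sub_le_self _ (by positivity))
  exact ⟨key _ (by linarith) (by linarith), fun _ => key _ (by linarith) (by linarith)⟩
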